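/- For positive real numbers $a,b$ and real $r\neq 1$ let $$C_r(a,b)=\Big(\frac{b^r+a^r}{b+a}\Big)^{\frac1{r-1}},\qquad\text{and let}\qquad C_1(a,b)=\lim_{r\to1}C_r(a,b)=\big(b^b a^a\big)^{\frac1{b+a}} .$$ Let $0<r<\infty$ and $b>a>0$. Then $$C_r(a,b)+C_{-r}(a,b)<\sqrt{\frac{3a^2+2ab+3b^2}{2}}$$ and $$C_r(a,b)^2+C_{-r}(a,b)^2>\frac{(a+b)^2}{2}.$$ -/

import Mathlib

noncomputable section

/-- The generalized inverse harmonic mean `C_r(a, b) = ((b^r + a^r) / (b + a)) ^ (1 / (r - 1))` of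
two positive numbers, for real `r`. At the removable singularity `r = 1` it takes the limiting
value `C_1(a, b) = (b^b a^a) ^ (1 / (b + a))`. -/
def genInvHarmonicMean (r a b : ℝ) : ℝ :=
  if r = 1 then (b ^ b * a ^ a) ^ (1 / (b + a))
  else ((b ^ r + a ^ r) / (b + a)) ^ (1 / (r - 1))

end

/-! Write a = e^(g-t), b = e^(g+t), L = log cosh, and S = (L(rt) - L(t))/(r² - 1), with S = t
tanh(t)/2 when r = 1. Then C_r and C_{-r} equal e^(g+S±rS), so both claims become bounds on e^S
cosh(rS) and e^(2S) cosh(2rS) in terms of cosh t.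

The core is that on t > 0 the quotient L(L+1)/t² strictly increases while L(L+3)/t² decreases.
Compared at t and rt and rewritten with l = L(t) - S = L(rt) - r²S, this says l(l+1) < (rS)² ≤
l(l+3). The left bound gives the inequality for squares, through x² ≤ 2L(x) + L(x)². The right bound
gives the inequality for the sum when l is small; when l is large, (1+r)S ≤ t, which holds because L
is 1-Lipschitz, takes over. -/

theorem nonneg_of_hasDerivAt_nonneg {f f' : ℝ → ℝ} {x : ℝ} (hf : ∀ t, 0 ≤ t → HasDerivAt f (f' t) t)
    (h0 : f 0 = 0) (hx : 0 ≤ x) (h : ∀ t, 0 < t → t < x → 0 ≤ f' t) : 0 ≤ f x := by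
  have := monotoneOn_of_deriv_nonneg (convex_Icc (0 : ℝ) x)
    (fun t ht => (hf t ht.1).continuousAt.continuousWithinAt)
    (fun t ht => by
      rw [interior_Icc] at ht
      exact (hf t ht.1.le).differentiableAt.differentiableWithinAt)
    (fun t ht => by
      rw [interior_Icc] at ht
      rw [(hf t ht.1.le).deriv]
      exact h t ht.1 ht.2)
  simpa [h0] using this (Set.left_mem_Icc.2 hx) (Set.right_mem_Icc.2 hx) hx

theorem pos_of_hasDerivAt_pos {f f' : ℝ → ℝ} {x : ℝ} (hf : ∀ t, 0 ≤ t → HasDerivAt f (f' t) t)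
    (h0 : f 0 = 0) (hx : 0 < x) (h : ∀ t, 0 < t → t < x → 0 < f' t) : 0 < f x := by
  have := strictMonoOn_of_deriv_pos (convex_Icc (0 : ℝ) x)
    (fun t ht => (hf t ht.1).continuousAt.continuousWithinAt)
    (fun t ht => by
      rw [interior_Icc] at ht
      rw [(hf t ht.1.le).deriv]
      exact h t ht.1 ht.2)
  simpa [h0] using this (Set.left_mem_Icc.2 hx.le) (Set.right_mem_Icc.2 hx.le) hx

/-- The logarithm of the hyperbolic cosine. -/
noncomputable def logCosh (t : ℝ) : ℝ := Real.log (Real.cosh t)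

theorem exp_logCosh (t : ℝ) : Real.exp (logCosh t) = Real.cosh t := Real.exp_log (Real.cosh_pos t)

theorem logCosh_zero : logCosh 0 = 0 := by simp [logCosh]

theorem logCosh_nonneg (t : ℝ) : 0 ≤ logCosh t := Real.log_nonneg (Real.one_le_cosh t)

theorem logCosh_pos {t : ℝ} (ht : 0 < t) : 0 < logCosh t :=
  Real.log_pos (Real.one_lt_cosh.2 ht.ne')

theorem hasDerivAt_logCosh (t : ℝ) : HasDerivAt logCosh (Real.tanh t) t := by
  rw [Real.tanh_eq_sinh_div_cosh]
  exact (Real.hasDerivAt_cosh t).log (Real.cosh_pos t).ne'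

theorem one_sub_tanh_sq (t : ℝ) : 1 - Real.tanh t ^ 2 = 1 / Real.cosh t ^ 2 := by
  have := Real.cosh_sq t
  have h := (Real.cosh_pos t).ne'
  rw [Real.tanh_eq_sinh_div_cosh]
  field_simp
  linarith

theorem hasDerivAt_tanh_one_sub_sq (t : ℝ) :
    HasDerivAt Real.tanh (1 - Real.tanh t ^ 2) t := by
  have h := (Real.cosh_pos t).ne'
  have := (Real.hasDerivAt_sinh t).div (Real.hasDerivAt_cosh t) h
  have e : Real.tanh = Real.sinh / Real.cosh := by
    funext x; simp [Real.tanh_eq_sinh_div_cosh]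
  rw [e]
  refine this.congr_deriv ?_
  simp only [Pi.div_apply]
  field_simp

theorem tanh_pos_of_pos {t : ℝ} (ht : 0 < t) : 0 < Real.tanh t := by
  rw [Real.tanh_eq_sinh_div_cosh]
  exact div_pos (Real.sinh_pos_iff.2 ht) (Real.cosh_pos t)

theorem tanh_sq_lt_one (t : ℝ) : Real.tanh t ^ 2 < 1 := by
  have := one_sub_tanh_sq t
  have h : 0 < 1 / Real.cosh t ^ 2 := by have := Real.cosh_pos t; positivity
  linarith

/-! ### Differential inequalities for log cosh. -/

theorem le_tanh_mul_one_add_logCosh {t : ℝ} (ht : 0 ≤ t) :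
    t ≤ Real.tanh t * (1 + logCosh t) := by
  have := nonneg_of_hasDerivAt_nonneg (f := fun t => Real.tanh t * (1 + logCosh t) - t)
    (f' := fun t => (1 - Real.tanh t ^ 2) * (1 + logCosh t) + Real.tanh t * Real.tanh t - 1)
    (x := t) (fun s _ => ((hasDerivAt_tanh_one_sub_sq s).mul
      ((hasDerivAt_logCosh s).const_add 1)).sub (hasDerivAt_id s)) (by simp) ht
    (fun s _ _ => by nlinarith [tanh_sq_lt_one s, logCosh_nonneg s])
  simpa using this

theorem sq_le_two_mul_logCosh_add_sq {t : ℝ} (ht : 0 ≤ t) :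
    t ^ 2 ≤ 2 * logCosh t + logCosh t ^ 2 := by
  have := nonneg_of_hasDerivAt_nonneg (f := fun t => 2 * logCosh t + logCosh t ^ 2 - t ^ 2)
    (f' := fun t => 2 * Real.tanh t + 2 * logCosh t * Real.tanh t - 2 * t)
    (x := t) (fun s _ => by
      have h := (((hasDerivAt_logCosh s).const_mul 2).add ((hasDerivAt_logCosh s).pow 2)).sub
        ((hasDerivAt_id s).pow 2)
      refine h.congr_deriv ?_
      simp) (by simp [logCosh_zero]) ht
    (fun s hs _ => by nlinarith [le_tanh_mul_one_add_logCosh hs.le])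
  simpa using this

theorem hasDerivAt_mul_tanh_sub_logCosh (t : ℝ) :
    HasDerivAt (fun t => t * Real.tanh t - logCosh t) (t * (1 - Real.tanh t ^ 2)) t := by
  have h := ((hasDerivAt_id t).mul (hasDerivAt_tanh_one_sub_sq t)).sub (hasDerivAt_logCosh t)
  refine h.congr_deriv ?_
  simp

theorem logCosh_le_mul_tanh {t : ℝ} (ht : 0 ≤ t) : logCosh t ≤ t * Real.tanh t := by
  have := nonneg_of_hasDerivAt_nonneg (x := t) (fun s _ => hasDerivAt_mul_tanh_sub_logCosh s)
    (by simp [logCosh_zero]) ht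
    (fun s hs _ => mul_nonneg hs.le (by linarith [tanh_sq_lt_one s]))
  simpa using this

theorem tanh_lt_self {t : ℝ} (ht : 0 < t) : Real.tanh t < t := by
  have := pos_of_hasDerivAt_pos (f := fun t => t - Real.tanh t)
    (f' := fun t => 1 - (1 - Real.tanh t ^ 2))
    (x := t) (fun s _ => (hasDerivAt_id s).sub (hasDerivAt_tanh_one_sub_sq s)) (by simp) ht
    (fun s hs _ => by have := tanh_pos_of_pos hs; nlinarith)
  simpa using this

theorem hasDerivAt_half_sinh_two_mul (t : ℝ) :
    HasDerivAt (fun t => Real.sinh (2 * t) / 2) (2 * Real.exp (2 * logCosh t) - 1) t := by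
  have h := ((Real.hasDerivAt_sinh (2 * t)).comp t ((hasDerivAt_id t).const_mul 2)).div_const 2
  refine h.congr_deriv ?_
  have e : Real.exp (2 * logCosh t) = Real.cosh t ^ 2 := by
    rw [← exp_logCosh, ← Real.exp_nat_mul]; norm_num
  rw [e, Real.cosh_two_mul, Real.sinh_sq]
  ring

theorem tanh_eq_mul_sinh_two_mul (t : ℝ) :
    Real.tanh t = (1 - Real.tanh t ^ 2) * (Real.sinh (2 * t) / 2) := by
  rw [one_sub_tanh_sq, Real.sinh_two_mul, Real.tanh_eq_sinh_div_cosh]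
  have h := (Real.cosh_pos t).ne'
  field_simp

theorem mul_one_add_sq_le_half_sinh {t : ℝ} (ht : 0 ≤ t) :
    t * (1 + 2 * logCosh t / 3) ^ 2 ≤ Real.sinh (2 * t) / 2 := by
  have := nonneg_of_hasDerivAt_nonneg
    (f := fun t => Real.sinh (2 * t) / 2 - t * (1 + 2 * logCosh t / 3) ^ 2)
    (f' := fun t => 2 * Real.exp (2 * logCosh t) - 1 - ((1 + 2 * logCosh t / 3) ^ 2
      + t * (2 * (1 + 2 * logCosh t / 3) * (2 * Real.tanh t / 3))))
    (x := t) (fun s _ => by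
      have h := (hasDerivAt_half_sinh_two_mul s).sub ((hasDerivAt_id s).mul
        (((((hasDerivAt_logCosh s).const_mul 2).div_const 3).const_add 1).pow 2))
      refine h.congr_deriv ?_
      simp) (by simp) ht
    (fun s hs _ => by
      have h1 := sq_le_two_mul_logCosh_add_sq hs.le
      have h2 := tanh_lt_self hs
      have h3 := logCosh_nonneg s
      have h4 : 1 + 2 * logCosh s + (2 * logCosh s) ^ 2 / 2 + (2 * logCosh s) ^ 3 / 6
          ≤ Real.exp (2 * logCosh s) := by
        have := Real.sum_le_exp_of_nonneg (x := 2 * logCosh s) (by linarith) 4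
        simp [Finset.sum_range_succ, Nat.factorial] at this
        linarith
      -- Since s tanh s ≤ s², the derivative is bounded below by a polynomial in `logCosh s`.
      have h5 : s * Real.tanh s ≤ 2 * logCosh s + logCosh s ^ 2 := by nlinarith
      have h6 := mul_le_mul_of_nonneg_left h5 (by linarith : (0:ℝ) ≤ 1 + 2 * logCosh s / 3)
      have h7 : 0 ≤ logCosh s ^ 2 := by positivity
      have h8 : 0 ≤ logCosh s ^ 3 := by positivity
      nlinarith)
  simpa using this

theorem hasDerivAt_logCosh_mul_div (c t : ℝ) (hc : 0 < c) :
    HasDerivAt (fun t => c * logCosh t / (2 * logCosh t + c))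
      (c ^ 2 * Real.tanh t / (2 * logCosh t + c) ^ 2) t := by
  have hL := logCosh_nonneg t
  have hd : 2 * logCosh t + c ≠ 0 := by positivity
  have h := ((hasDerivAt_logCosh t).const_mul c).div
    (((hasDerivAt_logCosh t).const_mul 2).add_const c) hd
  refine h.congr_deriv ?_
  ring

/-- This is the sign of the derivative of L(L+3)/t². It rearranges to t tanh t - L ≤ 3L/(2L+3);
differentiating both sides and dividing by 1 - tanh² leaves `mul_one_add_sq_le_half_sinh`. -/
theorem mul_tanh_mul_le {t : ℝ} (ht : 0 ≤ t) :
    t * Real.tanh t * (2 * logCosh t + 3) ≤ 2 * logCosh t * (logCosh t + 3) := by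
  have := nonneg_of_hasDerivAt_nonneg (x := t) (fun s _ =>
      (hasDerivAt_logCosh_mul_div 3 s three_pos).sub (hasDerivAt_mul_tanh_sub_logCosh s))
    (by simp [logCosh_zero]) ht
    (fun s hs _ => by
      have hL := logCosh_nonneg s
      have h1 := mul_one_add_sq_le_half_sinh hs.le
      have h2 := tanh_eq_mul_sinh_two_mul s
      have h3 := tanh_sq_lt_one s
      rw [sub_nonneg, le_div_iff₀ (by positivity)]
      have := mul_le_mul_of_nonneg_left h1 (sub_pos.2 h3).le
      rw [← h2] at this
      linarith)
  have hL := logCosh_nonneg t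
  have h2 : t * Real.tanh t - logCosh t ≤ 3 * logCosh t / (2 * logCosh t + 3) := by
    simpa using this
  rw [le_div_iff₀ (by positivity)] at h2
  linarith

/-- Used with v = 2L(s), s ≤ 2. On [1, 14/5] the chord of the convex exponential already lies below
the quadratic. -/
theorem exp_lt_quadratic {v : ℝ} (h0 : 0 < v) (h1 : v ≤ 14 / 5) :
    Real.exp v < 1 + 2 * v + 3 / 2 * v ^ 2 := by
  rcases le_total v 1 with h | h
  · have := (abs_le.1 (Real.abs_exp_sub_one_sub_id_le (x := v) (by rw [abs_of_pos h0]; exact h))).2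
    nlinarith
  · have hE : Real.exp (14 / 5) ≤ 33 / 2 := by
      refine le_of_pow_le_pow_left₀ (n := 5) (by norm_num) (by norm_num) ?_
      rw [← Real.exp_nat_mul, show ((5 : ℕ) : ℝ) * (14 / 5) = ((14 : ℕ) : ℝ) * 1 by norm_num,
        Real.exp_nat_mul]
      calc Real.exp 1 ^ 14 ≤ 2.7182818286 ^ 14 := by
            gcongr; exact Real.exp_one_lt_d9.le
        _ ≤ _ := by norm_num
    have h3 := convexOn_exp.2 (Set.mem_univ 1) (Set.mem_univ (14 / 5 : ℝ))
      (show 0 ≤ (14 / 5 - v) * (5 / 9) by linarith) (show 0 ≤ (v - 1) * (5 / 9) by linarith)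
      (by ring)
    simp only [smul_eq_mul] at h3
    rw [show (14 / 5 - v) * (5 / 9) * 1 + (v - 1) * (5 / 9) * (14 / 5) = v by ring] at h3
    have h4 := Real.exp_one_lt_d9
    have h5 : (14 / 5 - v) * (5 / 9) * Real.exp 1 ≤ (14 / 5 - v) * (5 / 9) * 2.7182818286 :=
      mul_le_mul_of_nonneg_left h4.le (by linarith)
    have h6 : (v - 1) * (5 / 9) * Real.exp (14 / 5) ≤ (v - 1) * (5 / 9) * (33 / 2) :=
      mul_le_mul_of_nonneg_left hE (by linarith)
    norm_num at h5
    -- The gap between the quadratic and the chord is smallest near v = 1.88.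
    nlinarith [sq_nonneg (v - 1.88)]

theorem logCosh_two_le : logCosh 2 ≤ 7 / 5 := by
  rw [logCosh, Real.log_le_iff_le_exp (Real.cosh_pos 2), Real.cosh_eq]
  have h1 : Real.exp (3 / 5) ≤ 19 / 10 := by
    refine le_of_pow_le_pow_left₀ (n := 5) (by norm_num) (by norm_num) ?_
    rw [← Real.exp_nat_mul, show ((5 : ℕ) : ℝ) * (3 / 5) = ((3 : ℕ) : ℝ) * 1 by norm_num,
      Real.exp_nat_mul]
    calc Real.exp 1 ^ 3 ≤ 2.7182818286 ^ 3 := by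
          gcongr; exact Real.exp_one_lt_d9.le
      _ ≤ _ := by norm_num
  have h2 : Real.exp 2 = Real.exp (7 / 5) * Real.exp (3 / 5) := by
    rw [← Real.exp_add]; norm_num
  have h3 : Real.exp (-2) ≤ 1 / 7 := by
    rw [Real.exp_neg, ← one_div]
    gcongr
    rw [show (2 : ℝ) = ((2 : ℕ) : ℝ) * 1 by norm_num, Real.exp_nat_mul]
    calc (7 : ℝ) ≤ 2.7182818283 ^ 2 := by norm_num
      _ ≤ _ := by gcongr; exact Real.exp_one_gt_d9.le
  have h4 : 3 ≤ Real.exp (7 / 5) := by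
    have := Real.quadratic_le_exp_of_nonneg (x := 7 / 5) (by norm_num)
    linarith
  nlinarith

theorem tanh_two_ge : 19 / 20 ≤ Real.tanh 2 := by
  have h : 7 ≤ Real.exp 2 := by
    rw [show (2 : ℝ) = ((2 : ℕ) : ℝ) * 1 by norm_num, Real.exp_nat_mul]
    calc (7 : ℝ) ≤ 2.7182818283 ^ 2 := by norm_num
      _ ≤ _ := by gcongr; exact Real.exp_one_gt_d9.le
  have h' : Real.exp 2 * Real.exp (-2) = 1 := by rw [← Real.exp_add]; simp
  rw [Real.tanh_eq_sinh_div_cosh, le_div_iff₀ (Real.cosh_pos 2), Real.cosh_eq, Real.sinh_eq]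
  nlinarith [Real.exp_pos (-2)]

/-- With v = 2L and t tanh t ≥ L, positivity of the derivative reduces to `exp_lt_quadratic`. A
cutoff in t is unavoidable: sinh outgrows the right side. -/
theorem half_sinh_lt_mul_one_add_sq {t : ℝ} (ht : 0 < t) (ht2 : t ≤ 2) :
    Real.sinh (2 * t) / 2 < t * (2 * logCosh t + 1) ^ 2 := by
  have := pos_of_hasDerivAt_pos
    (f := fun t => t * (2 * logCosh t + 1) ^ 2 - Real.sinh (2 * t) / 2)
    (f' := fun t => (2 * logCosh t + 1) ^ 2
      + t * (2 * (2 * logCosh t + 1) * (2 * Real.tanh t)) - (2 * Real.exp (2 * logCosh t) - 1))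
    (x := t) (fun s _ => by
      have h := ((hasDerivAt_id s).mul
        ((((hasDerivAt_logCosh s).const_mul 2).add_const 1).pow 2)).sub
        (hasDerivAt_half_sinh_two_mul s)
      refine h.congr_deriv ?_
      simp) (by simp) ht
    (fun s hs hst => by
      have h1 := logCosh_le_mul_tanh hs.le
      have h3 := logCosh_pos hs
      have h2 : logCosh s ≤ logCosh 2 :=
        Real.log_le_log (Real.cosh_pos s) (Real.cosh_le_cosh.2 (by
          rw [abs_of_pos hs, abs_of_pos two_pos]; linarith))
      have h4 := exp_lt_quadratic (v := 2 * logCosh s) (by linarith)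
        (by linarith [logCosh_two_le])
      nlinarith)
  simpa using this

theorem half_le_mul_tanh_sub_logCosh {t : ℝ} (ht : 2 ≤ t) :
    1 / 2 ≤ t * Real.tanh t - logCosh t := by
  have := monotoneOn_of_deriv_nonneg (convex_Ici (0 : ℝ))
    (fun s _ => (hasDerivAt_mul_tanh_sub_logCosh s).continuousAt.continuousWithinAt)
    (fun s _ => (hasDerivAt_mul_tanh_sub_logCosh s).differentiableAt.differentiableWithinAt)
    (fun s hs => by
      rw [interior_Ici] at hs
      rw [(hasDerivAt_mul_tanh_sub_logCosh s).deriv]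
      exact mul_nonneg (le_of_lt hs) (by linarith [tanh_sq_lt_one s]))
  have h := this (a := 2) (b := t) (by simp) (by simp; linarith) ht
  have h1 := logCosh_two_le
  have h2 := tanh_two_ge
  simp only at h
  linarith

/-- Equivalent to L/(2L+1) < t tanh t - L. Up to t = 2 the derivatives compare; beyond it the right
side is at least 1/2, which exceeds the left. -/
theorem lt_mul_tanh_mul {t : ℝ} (ht : 0 < t) :
    2 * logCosh t * (logCosh t + 1) < t * Real.tanh t * (2 * logCosh t + 1) := by
  have hL := logCosh_nonneg t
  rcases le_total t 2 with h2 | h2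
  · have := pos_of_hasDerivAt_pos (x := t) (fun s _ =>
      (hasDerivAt_mul_tanh_sub_logCosh s).sub (hasDerivAt_logCosh_mul_div 1 s one_pos))
      (by simp [logCosh_zero]) ht
      (fun s hs hst => by
        have hL := logCosh_nonneg s
        have h1 := half_sinh_lt_mul_one_add_sq hs (hst.le.trans h2)
        have h2 := tanh_eq_mul_sinh_two_mul s
        have h3 := tanh_sq_lt_one s
        rw [sub_pos, div_lt_iff₀ (by positivity)]
        have := mul_lt_mul_of_pos_left h1 (sub_pos.2 h3)
        rw [← h2] at this
        linarith)
    have h2 : 1 * logCosh t / (2 * logCosh t + 1) < t * Real.tanh t - logCosh t := by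
      simpa using this
    rw [div_lt_iff₀ (by positivity)] at h2
    linarith
  · have := half_le_mul_tanh_sub_logCosh h2
    nlinarith

/-! ### Monotone quotients and bounds on the chord slope. -/

theorem hasDerivAt_logCosh_mul_div_sq (c : ℝ) {t : ℝ} (ht : 0 < t) :
    HasDerivAt (fun t => logCosh t * (logCosh t + c) / t ^ 2)
      ((t * Real.tanh t * (2 * logCosh t + c) - 2 * logCosh t * (logCosh t + c)) / t ^ 3) t := by
  have h := ((hasDerivAt_logCosh t).mul ((hasDerivAt_logCosh t).add_const c)).div
    ((hasDerivAt_id t).pow 2) (by simpa using ht.ne')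
  refine h.congr_deriv ?_
  simp
  field_simp
  ring

theorem strictMonoOn_logCosh_mul_add_one_div_sq :
    StrictMonoOn (fun t => logCosh t * (logCosh t + 1) / t ^ 2) (Set.Ioi 0) :=
  strictMonoOn_of_deriv_pos (convex_Ioi 0)
    (fun _ ht => (hasDerivAt_logCosh_mul_div_sq 1 ht).continuousAt.continuousWithinAt)
    (fun t ht => by
      rw [interior_Ioi] at ht
      rw [(hasDerivAt_logCosh_mul_div_sq 1 ht).deriv]
      exact div_pos (sub_pos.2 (lt_mul_tanh_mul ht)) (pow_pos ht 3))

theorem antitoneOn_logCosh_mul_add_three_div_sq :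
    AntitoneOn (fun t => logCosh t * (logCosh t + 3) / t ^ 2) (Set.Ioi 0) :=
  antitoneOn_of_deriv_nonpos (convex_Ioi 0)
    (fun _ ht => (hasDerivAt_logCosh_mul_div_sq 3 ht).continuousAt.continuousWithinAt)
    (fun t ht => by
      rw [interior_Ioi] at ht
      exact (hasDerivAt_logCosh_mul_div_sq 3 ht).differentiableAt.differentiableWithinAt)
    (fun t ht => by
      rw [interior_Ioi] at ht
      rw [(hasDerivAt_logCosh_mul_div_sq 3 ht).deriv]
      exact div_nonpos_of_nonpos_of_nonneg (sub_nonpos.2 (mul_tanh_mul_le (le_of_lt ht)))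
        (pow_nonneg (le_of_lt ht) 3))

theorem logCosh_add_le (t : ℝ) {h : ℝ} (hh : 0 ≤ h) : logCosh (t + h) ≤ logCosh t + h := by
  rw [← Real.exp_le_exp, Real.exp_add, exp_logCosh, exp_logCosh, Real.cosh_add,
    ← Real.cosh_add_sinh h]
  nlinarith [Real.sinh_lt_cosh t, Real.sinh_nonneg_iff.2 hh]

/-- The slope, scaled by `t ^ 2`, of the chord of `s ↦ log (cosh (√s))` between `t ^ 2` and
`(r * t) ^ 2`, and the corresponding tangent slope when `r = 1`. -/
noncomputable def logCoshSlope (r t : ℝ) : ℝ :=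
  if r = 1 then t * Real.tanh t / 2 else (logCosh (r * t) - logCosh t) / (r ^ 2 - 1)

section

variable {r t : ℝ}

theorem logCoshSlope_mul (hr : 0 < r) (r1 : r ≠ 1) :
    logCoshSlope r t * (r ^ 2 - 1) = logCosh (r * t) - logCosh t := by
  have : r ^ 2 - 1 ≠ 0 := by
    rw [show r ^ 2 - 1 = (r - 1) * (r + 1) by ring]
    exact mul_ne_zero (sub_ne_zero.2 r1) (by positivity)
  rw [logCoshSlope, if_neg r1, div_mul_cancel₀ _ this]

theorem logCosh_mul_sub_slope (hr : 0 < r) :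
    logCosh (r * t) - r ^ 2 * logCoshSlope r t = logCosh t - logCoshSlope r t := by
  by_cases r1 : r = 1
  · simp [r1]
  · linarith [logCoshSlope_mul (t := t) hr r1]

/-- With P = L(t), Q = L(rt), monotonicity compares Q(Q+1) with r²P(P+1). Subtract P(P+1), factor
out Q - P = S(r² - 1) and cancel r² - 1, minding its sign. -/
theorem lt_logCoshSlope_mul (hr : 0 < r) (ht : 0 < t) :
    logCosh t * (logCosh t + 1) < logCoshSlope r t * (logCosh t + logCosh (r * t) + 1) := by
  have hrt : 0 < r * t := by positivity
  by_cases r1 : r = 1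
  · have := lt_mul_tanh_mul ht
    simp only [logCoshSlope, r1, if_true, one_mul]
    linarith
  · have h := logCoshSlope_mul (t := t) hr r1
    rcases lt_or_gt_of_ne r1 with h1 | h1
    · have m := strictMonoOn_logCosh_mul_add_one_div_sq (Set.mem_Ioi.2 hrt) (Set.mem_Ioi.2 ht)
        (by nlinarith)
      simp only at m
      rw [mul_pow, div_lt_div_iff₀ (by positivity) (by positivity)] at m
      have m' : logCosh (r * t) * (logCosh (r * t) + 1) < r ^ 2 * (logCosh t * (logCosh t + 1)) :=
        lt_of_mul_lt_mul_right (by linarith) (sq_nonneg t)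
      have h2 : 0 < 1 - r ^ 2 := by nlinarith
      refine lt_of_mul_lt_mul_right ?_ h2.le
      linear_combination m' + (logCosh t + logCosh (r * t) + 1) * h
    · have m := strictMonoOn_logCosh_mul_add_one_div_sq (Set.mem_Ioi.2 ht) (Set.mem_Ioi.2 hrt)
        (by nlinarith)
      simp only at m
      rw [mul_pow, div_lt_div_iff₀ (by positivity) (by positivity)] at m
      have m' : r ^ 2 * (logCosh t * (logCosh t + 1)) < logCosh (r * t) * (logCosh (r * t) + 1) :=
        lt_of_mul_lt_mul_right (by linarith) (sq_nonneg t)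
      have h2 : 0 < r ^ 2 - 1 := by nlinarith
      refine lt_of_mul_lt_mul_right ?_ h2.le
      linear_combination m' - (logCosh t + logCosh (r * t) + 1) * h

theorem logCoshSlope_mul_le (hr : 0 < r) (ht : 0 < t) :
    logCoshSlope r t * (logCosh t + logCosh (r * t) + 3) ≤ logCosh t * (logCosh t + 3) := by
  have hrt : 0 < r * t := by positivity
  by_cases r1 : r = 1
  · have := mul_tanh_mul_le ht.le
    simp only [logCoshSlope, r1, if_true, one_mul]
    linarith
  · have h := logCoshSlope_mul (t := t) hr r1
    rcases lt_or_gt_of_ne r1 with h1 | h1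
    · have m := antitoneOn_logCosh_mul_add_three_div_sq (Set.mem_Ioi.2 hrt) (Set.mem_Ioi.2 ht)
        (by nlinarith)
      simp only at m
      rw [mul_pow, div_le_div_iff₀ (by positivity) (by positivity)] at m
      have m' : r ^ 2 * (logCosh t * (logCosh t + 3)) ≤ logCosh (r * t) * (logCosh (r * t) + 3) :=
        le_of_mul_le_mul_right (by linarith) (pow_pos ht 2)
      have h2 : 0 < 1 - r ^ 2 := by nlinarith
      refine le_of_mul_le_mul_right ?_ h2
      linear_combination m' - (logCosh t + logCosh (r * t) + 3) * h
    · have m := antitoneOn_logCosh_mul_add_three_div_sq (Set.mem_Ioi.2 ht) (Set.mem_Ioi.2 hrt)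
        (by nlinarith)
      simp only at m
      rw [mul_pow, div_le_div_iff₀ (by positivity) (by positivity)] at m
      have m' : logCosh (r * t) * (logCosh (r * t) + 3) ≤ r ^ 2 * (logCosh t * (logCosh t + 3)) :=
        le_of_mul_le_mul_right (by linarith) (pow_pos ht 2)
      have h2 : 0 < r ^ 2 - 1 := by nlinarith
      refine le_of_mul_le_mul_right ?_ h2
      linear_combination m' + (logCosh t + logCosh (r * t) + 3) * h

theorem one_add_mul_logCoshSlope_le (hr : 0 < r) (ht : 0 < t) :
    (1 + r) * logCoshSlope r t ≤ t := by
  by_cases r1 : r = 1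
  · simp only [logCoshSlope, r1, if_true]
    have h1 : Real.tanh t < 1 := by nlinarith [tanh_sq_lt_one t, tanh_pos_of_pos ht]
    nlinarith
  · have h := logCoshSlope_mul (t := t) hr r1
    rcases lt_or_gt_of_ne r1 with h1 | h1
    · have m := logCosh_add_le (r * t) (h := t - r * t) (by nlinarith)
      rw [add_sub_cancel] at m
      exact le_of_mul_le_mul_right (by linear_combination m - h) (sub_pos.2 h1)
    · have m := logCosh_add_le t (h := r * t - t) (by nlinarith)
      rw [add_sub_cancel] at m
      exact le_of_mul_le_mul_right (by linear_combination m + h) (sub_pos.2 h1)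

/-! ### The two estimates in normalized coordinates. -/

theorem cosh_sq_lt_exp_slope_mul_cosh (hr : 0 < r) (ht : 0 < t) :
    Real.cosh t ^ 2 <
      Real.exp (2 * logCoshSlope r t) * Real.cosh (2 * (r * logCoshSlope r t)) := by
  have e := logCosh_mul_sub_slope (t := t) hr
  have h1 := lt_logCoshSlope_mul hr ht
  have h3 := logCoshSlope_mul_le hr ht
  have hP := logCosh_pos ht
  have hQ := logCosh_pos (mul_pos hr ht)
  generalize logCosh (r * t) = Q at *
  generalize logCoshSlope r t = S at *
  have hS : 0 < S := by
    by_contra! h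
    nlinarith
  have hl : 0 ≤ logCosh t - S := by
    by_contra! h
    nlinarith
  have hz : (logCosh t - S) * (logCosh t - S + 1) < (r * S) ^ 2 := by
    linear_combination h1 + S * e
  -- Otherwise x² ≤ 2L(x) + L(x)² at x = 2rS gives (rS)² ≤ l(l+1), against `hz`.
  have key : 2 * (logCosh t - S) < logCosh (2 * (r * S)) := by
    by_contra! h
    have := sq_le_two_mul_logCosh_add_sq (t := 2 * (r * S)) (by positivity)
    nlinarith [logCosh_nonneg (2 * (r * S))]
  rw [← exp_logCosh, ← exp_logCosh (2 * (r * S)), ← Real.exp_add, ← Real.exp_nat_mul,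
    Real.exp_lt_exp]
  push_cast
  linarith

theorem exp_neg_le_quadratic {x : ℝ} (hx : 0 ≤ x) : Real.exp (-x) ≤ 1 - x + x ^ 2 / 2 := by
  have h := Real.quadratic_le_exp_of_nonneg hx
  rw [Real.exp_neg, inv_le_iff_one_le_mul₀ (Real.exp_pos x)]
  nlinarith [sq_nonneg (x ^ 2), sq_nonneg (x - 1)]

theorem exp_slope_mul_cosh_sq_lt (hr : 0 < r) (ht : 0 < t) :
    (Real.exp (logCoshSlope r t) * Real.cosh (r * logCoshSlope r t)) ^ 2 <
      (3 * Real.cosh t ^ 2 - 1) / 2 := by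
  have e := logCosh_mul_sub_slope (t := t) hr
  have h1 := lt_logCoshSlope_mul hr ht
  have h3 := logCoshSlope_mul_le hr ht
  have hzt := one_add_mul_logCoshSlope_le hr ht
  have hP := logCosh_pos ht
  have hQ := logCosh_pos (mul_pos hr ht)
  generalize logCosh (r * t) = Q at *
  generalize logCoshSlope r t = S at *
  have hS : 0 < S := by
    by_contra! h
    nlinarith
  have hl : 0 ≤ logCosh t - S := by
    by_contra! h
    nlinarith
  have hz : (r * S) ^ 2 ≤ (logCosh t - S) * (logCosh t - S + 3) := by
    linear_combination h3 - S * e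
  obtain ⟨l, hl'⟩ : ∃ l, l = logCosh t - S := ⟨_, rfl⟩
  rw [← hl'] at hl hz
  have hd0 := tanh_pos_of_pos ht
  have hd1 := tanh_sq_lt_one t
  have hC := Real.cosh_pos t
  have hd : (3 * Real.cosh t ^ 2 - 1) / 2 = Real.cosh t ^ 2 * (1 + Real.tanh t ^ 2 / 2) := by
    have := one_sub_tanh_sq t
    field_simp at this
    linarith
  have hbase : Real.exp S = Real.cosh t * Real.exp (-l) := by
    rw [← exp_logCosh, ← Real.exp_add]
    congr 1
    linarith
  rw [hd, hbase, mul_assoc, mul_pow]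
  refine mul_lt_mul_of_pos_left ?_ (by positivity)
  obtain ⟨d, hd'⟩ : ∃ d, d = Real.tanh t := ⟨_, rfl⟩
  rw [← hd'] at hd0 hd1 ⊢
  have hd2 : d < 1 := by nlinarith
  -- The goal is now (e^(-l) cosh(rS))² < 1 + d²/2. For small l, cosh x ≤ e^(x²/2) bounds the left
  -- side by e^(l+l²); for large l, rS ≤ t - L(t) + l and e^(t-L(t)) = 1 + d.
  rcases lt_or_ge l (d ^ 2 / 4) with hc | hc
  · have hcosh : Real.cosh (r * S) ^ 2 ≤ Real.exp ((r * S) ^ 2) := by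
      have := pow_le_pow_left₀ (Real.cosh_pos _).le (Real.cosh_le_exp_half_sq (r * S)) 2
      rw [← Real.exp_nat_mul] at this
      refine this.trans_eq ?_
      congr 1
      push_cast
      ring
    obtain ⟨u, hu⟩ : ∃ u, u = d ^ 2 / 4 := ⟨_, rfl⟩
    rw [show 1 + d ^ 2 / 2 = 1 + 2 * u by linarith]
    rw [← hu] at hc
    have hu4 : u < 1 / 4 := by linarith
    calc (Real.exp (-l) * Real.cosh (r * S)) ^ 2
        = Real.exp (-l) ^ 2 * Real.cosh (r * S) ^ 2 := by ring
      _ ≤ Real.exp (-l) ^ 2 * Real.exp (l * (l + 3)) := by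
        gcongr
        exact hcosh.trans (Real.exp_le_exp.2 hz)
      _ = Real.exp (l + l ^ 2) := by
        rw [← Real.exp_nat_mul, ← Real.exp_add]
        congr 1
        push_cast
        ring
      _ < Real.exp (u + u ^ 2) := by
        rw [Real.exp_lt_exp]
        gcongr
      _ ≤ 1 + (u + u ^ 2) + (u + u ^ 2) ^ 2 := by
        have := (abs_le.1 (Real.abs_exp_sub_one_sub_id_le (x := u + u ^ 2)
          (by rw [abs_of_nonneg (by nlinarith)]; nlinarith))).2
        linarith
      _ ≤ 1 + 2 * u := by
        have : 0 ≤ u := hl.trans hc.le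
        have h2 : u ^ 2 ≤ u / 4 := by nlinarith
        nlinarith
  · have hx : Real.exp (t - logCosh t) = 1 + d := by
      rw [Real.exp_sub, exp_logCosh, ← Real.cosh_add_sinh, hd', Real.tanh_eq_sinh_div_cosh]
      field_simp
    have hcosh : Real.cosh (r * S) ≤ Real.cosh (t - logCosh t + l) := by
      rw [Real.cosh_le_cosh, abs_of_pos (by positivity)]
      refine le_trans ?_ (le_abs_self _)
      linarith
    have hw : Real.exp (-(2 * l)) ≤ 1 - d ^ 2 / 2 + d ^ 4 / 8 := by
      calc Real.exp (-(2 * l)) ≤ Real.exp (-(d ^ 2 / 2)) := by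
            rw [Real.exp_le_exp]; linarith
        _ ≤ _ := exp_neg_le_quadratic (by positivity)
        _ = _ := by ring
    have hb : Real.exp (-l) * Real.cosh (r * S)
        ≤ (1 + d + (1 - d ^ 2 / 2 + d ^ 4 / 8) / (1 + d)) / 2 := by
      calc Real.exp (-l) * Real.cosh (r * S)
          ≤ Real.exp (-l) * Real.cosh (t - logCosh t + l) := by gcongr
        _ = (1 + d + Real.exp (-(2 * l)) / (1 + d)) / 2 := by
          rw [← hx, ← Real.exp_sub, Real.cosh_eq, mul_div_assoc', mul_add, ← Real.exp_add,
            ← Real.exp_add]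
          ring_nf
        _ ≤ _ := by gcongr
    calc (Real.exp (-l) * Real.cosh (r * S)) ^ 2
        ≤ ((1 + d + (1 - d ^ 2 / 2 + d ^ 4 / 8) / (1 + d)) / 2) ^ 2 :=
          pow_le_pow_left₀ (mul_pos (Real.exp_pos _) (Real.cosh_pos _)).le hb 2
      _ < 1 + d ^ 2 / 2 := by
        have e1 : (1 + d + (1 - d ^ 2 / 2 + d ^ 4 / 8) / (1 + d)) / 2
            = (2 + 2 * d + d ^ 2 / 2 + d ^ 4 / 8) / (2 * (1 + d)) := by
          field_simp
          ring
        rw [e1, div_pow, div_lt_iff₀ (by positivity)]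
        -- After clearing denominators the two sides agree through degree 2; the surplus 2d³ absorbs
        -- the negative terms in d⁵, d⁶, d⁸.
        have p3 : 0 < d ^ 3 := by positivity
        have p5 : d ^ 5 ≤ d ^ 3 := pow_le_pow_of_le_one hd0.le hd2.le (by norm_num)
        have p6 : d ^ 6 ≤ d ^ 3 := pow_le_pow_of_le_one hd0.le hd2.le (by norm_num)
        have p8 : d ^ 8 ≤ d ^ 3 := pow_le_pow_of_le_one hd0.le hd2.le (by norm_num)
        have p4 : 0 < d ^ 4 := by positivity
        nlinarith

end

/-! ### The means in logarithmic coordinates. -/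

theorem exp_add_add_exp_sub (x y : ℝ) :
    Real.exp (x + y) + Real.exp (x - y) = 2 * Real.exp x * Real.cosh y := by
  rw [sub_eq_add_neg, Real.exp_add, Real.exp_add, Real.cosh_eq]
  ring

theorem genInvHarmonicMean_exp {s : ℝ} (hs : s ≠ 1) (g t : ℝ) :
    genInvHarmonicMean s (Real.exp (g - t)) (Real.exp (g + t))
      = Real.exp (g + (logCosh (s * t) - logCosh t) / (s - 1)) := by
  have h1 : s - 1 ≠ 0 := sub_ne_zero.2 hs
  have e : (Real.exp (g + t) ^ s + Real.exp (g - t) ^ s) / (Real.exp (g + t) + Real.exp (g - t))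
      = Real.exp (g * (s - 1) + (logCosh (s * t) - logCosh t)) := by
    rw [← Real.exp_mul, ← Real.exp_mul, add_mul, sub_mul, exp_add_add_exp_sub,
      exp_add_add_exp_sub, ← exp_logCosh, ← exp_logCosh t, mul_assoc, mul_assoc,
      mul_div_mul_left _ _ two_ne_zero, ← Real.exp_add, ← Real.exp_add, ← Real.exp_sub]
    ring_nf
  rw [genInvHarmonicMean, if_neg hs, e, ← Real.exp_mul]
  congr 1
  field_simp

theorem genInvHarmonicMean_one_exp (g t : ℝ) :
    genInvHarmonicMean 1 (Real.exp (g - t)) (Real.exp (g + t))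
      = Real.exp (g + t * Real.tanh t) := by
  have hc := Real.cosh_pos t
  rw [genInvHarmonicMean, if_pos rfl, ← Real.exp_mul, ← Real.exp_mul, ← Real.exp_add,
    ← Real.exp_mul, exp_add_add_exp_sub, Real.tanh_eq_sinh_div_cosh]
  congr 1
  rw [sub_eq_add_neg g t, Real.exp_add, Real.exp_add, ← Real.cosh_sub_sinh t,
    ← Real.cosh_add_sinh t]
  have := Real.exp_pos g
  field_simp
  ring

theorem genInvHarmonicMean_exp_eq_slope {r : ℝ} (hr : 0 < r) (g t : ℝ) :
    genInvHarmonicMean r (Real.exp (g - t)) (Real.exp (g + t))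
      = Real.exp (g + logCoshSlope r t + r * logCoshSlope r t) := by
  by_cases r1 : r = 1
  · rw [r1, genInvHarmonicMean_one_exp, logCoshSlope, if_pos rfl]
    ring_nf
  · rw [genInvHarmonicMean_exp r1, ← logCoshSlope_mul hr r1]
    have : r - 1 ≠ 0 := sub_ne_zero.2 r1
    congr 1
    field_simp
    ring

theorem genInvHarmonicMean_neg_exp_eq_slope {r : ℝ} (hr : 0 < r) (g t : ℝ) :
    genInvHarmonicMean (-r) (Real.exp (g - t)) (Real.exp (g + t))
      = Real.exp (g + logCoshSlope r t - r * logCoshSlope r t) := by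
  have e : logCosh (-r * t) - logCosh t = logCoshSlope r t * (r ^ 2 - 1) := by
    rw [neg_mul, logCosh, Real.cosh_neg, ← logCosh]
    linarith [logCosh_mul_sub_slope (t := t) hr]
  rw [genInvHarmonicMean_exp (by linarith), e]
  have : -r - 1 ≠ 0 := by linarith
  congr 1
  field_simp
  ring

theorem corollary6p1 (r a b : ℝ) (hr : 0 < r) (ha : 0 < a) (hab : a < b) :
    genInvHarmonicMean r a b + genInvHarmonicMean (-r) a b
        < Real.sqrt ((3 * a ^ 2 + 2 * a * b + 3 * b ^ 2) / 2) ∧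
      (a + b) ^ 2 / 2 < genInvHarmonicMean r a b ^ 2 + genInvHarmonicMean (-r) a b ^ 2 := by
  obtain ⟨g, t, ht, rfl, rfl⟩ : ∃ g t : ℝ, 0 < t ∧ a = Real.exp (g - t) ∧ b = Real.exp (g + t) := by
    refine ⟨(Real.log b + Real.log a) / 2, (Real.log b - Real.log a) / 2, ?_, ?_, ?_⟩
    · linarith [Real.log_lt_log ha hab]
    · ring_nf
      rw [Real.exp_log ha]
    · ring_nf
      rw [Real.exp_log (ha.trans hab)]
  have hG := Real.exp_pos g
  have hsum := exp_add_add_exp_sub g t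
  have hprod : Real.exp (g - t) * Real.exp (g + t) = Real.exp g ^ 2 := by
    rw [← Real.exp_add, ← Real.exp_nat_mul]
    ring_nf
  rw [genInvHarmonicMean_exp_eq_slope hr, genInvHarmonicMean_neg_exp_eq_slope hr]
  constructor
  · rw [exp_add_add_exp_sub, Real.exp_add]
    refine Real.lt_sqrt_of_sq_lt ?_
    have h := mul_lt_mul_of_pos_left (exp_slope_mul_cosh_sq_lt hr ht) (pow_pos hG 2)
    have e : (3 * Real.exp (g - t) ^ 2 + 2 * Real.exp (g - t) * Real.exp (g + t)
        + 3 * Real.exp (g + t) ^ 2) / 2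
        = 4 * (Real.exp g ^ 2 * ((3 * Real.cosh t ^ 2 - 1) / 2)) := by
      linear_combination (3 / 2 * (Real.exp (g + t) + Real.exp (g - t))
        + 3 * Real.exp g * Real.cosh t) * hsum - 2 * hprod
    rw [e]
    linarith
  · rw [← Real.exp_nat_mul, ← Real.exp_nat_mul, mul_add, mul_sub, exp_add_add_exp_sub, mul_add,
      add_comm (Real.exp (g - t)), hsum, Real.exp_add, Real.exp_nat_mul]
    have h := mul_lt_mul_of_pos_left (cosh_sq_lt_exp_slope_mul_cosh hr ht) (pow_pos hG 2)
    push_cast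
    linarith
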